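/- Consider deterministic, uniform, anonymous distributed algorithms in the multiset-broadcast model $\mathsf{MB}$. The input is a finite simple graph $G=(V,E)$. All nodes run the same algorithm; initially each node knows only its degree. In each synchronous round every node that has not yet halted computes its new state as a function of its current state and of the multiset of messages broadcast by its neighbors, where the message broadcast by a node is a function of that node's current state. A node that enters a stopping state remains in it and has an output associated with that state. Messages, states and local computation are unbounded. Let $\Gamma$ be a set of output labels containing $\texttt{yes}$, and let $\texttt{failed}\notin\Gamma$. A graph problem $\Pi$ assigns to each finite graph $G=(V,E)$ a set $\Pi(G)\subseteq\Gamma^V$ of solutions. Write $\mathcal A(G)\in\Pi(G)$ if on input $G$ all nodes halt and their outputs form an element of $\Pi(G)$. The algorithm $\mathcal A$ is *sound* for $\Pi$ if 1. $\mathcal A$ solves $\Pi$ asymptotically almost surely, that is, $\mathbb P_{G\sim G(n,1/2)}\big(\mathcal A(G)\in\Pi(G)\big)\to 1$ as $n\to\infty$; and 2. for every finite graph $G$ with $\mathcal A(G)\notin\Pi(G)$, all nodes halt on input $G$ with output $\texttt{failed}$. In the problem Hamiltonicity, $\sigma\in\Gamma^V$ is a solution on $G=(V,E)$ if and only if the following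 equivalence holds: at least one node $x$ has $\sigma(x)=\texttt{yes}$ if and only if $G$ contains a Hamiltonian cycle. **Theorem.** There is no sound $\mathsf{MB}$ algorithm for Hamiltonicity. Moreover, this remains true if only connected networks matter: if $\Pi$ is any graph problem such that for every connected graph $G$ the set $\Pi(G)$ is the set of solutions of Hamiltonicity on $G$ (with $\Pi(G)$ arbitrary for disconnected $G$), then there is no $\mathsf{MB}$ algorithm that satisfies condition 1 for $\Pi$ and satisfies condition 2 for every connected graph $G$. -/

import Mathlib

open Filter Topology

universe u v w

/-- The finite set of neighbours of a node of a finite graph. -/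
noncomputable def neighbours {V : Type} [Finite V] (G : SimpleGraph V) (x : V) : Finset V :=
  (Set.toFinite (G.neighborSet x)).toFinset

/-- What a halting node outputs: a label in `Γ` or the special value `failed`, which is not
in `Γ`. -/
inductive Output (Γ : Type u) : Type u where
  | label (γ : Γ) : Output Γ
  | failed : Output Γ

/-- A graph problem with label set `Γ`: it associates to every finite graph `G` with node set `V`
a set of labelings `V → Γ`, the solutions on input `G`. -/
def GraphProblem (Γ : Type u) : Type (max 1 u) :=
  ∀ (V : Type) [Finite V], SimpleGraph V → Set (V → Γ)

/-- A (deterministic, anonymous, uniform) algorithm in the multiset-broadcast model.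
All nodes run the same algorithm, and the only local input of a node is its degree.
Messages and local states are unbounded, and so is the local computation. -/
structure MBAlgorithm (Γ : Type u) where
  /-- local states -/
  State : Type v
  /-- messages -/
  Message : Type w
  /-- initial state, as a function of the degree -/
  init : ℕ → State
  /-- the message that a node in a given state broadcasts to all its neighbours -/
  broadcast : State → Message
  /-- the new state, as a function of the current state and of the multiset of the messages
  received from the neighbours -/
  update : State → Multiset Message → State
  /-- `none` if the state is not a stopping state; otherwise the output of a node that halts
  in this state -/
  output : State → Option (Output Γ)

namespace MBAlgorithm

variable {Γ : Type u} (A : MBAlgorithm.{u, v, w} Γ) {V : Type} [Finite V]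

open Classical in
/-- The state of each node after `r` synchronous rounds on input `G`. A node that has entered a
stopping state stays in it. -/
noncomputable def stateAfter (G : SimpleGraph V) : ℕ → V → A.State
  | 0, x => A.init (neighbours G x).card
  | r + 1, x =>
      if (A.output (stateAfter G r x)).isSome then stateAfter G r x
      else A.update (stateAfter G r x)
        ((neighbours G x).val.map fun y => A.broadcast (stateAfter G r y))

/-- On input `G` every node `x` eventually halts, with output `τ x`; that is, `𝒜(G) = τ`. -/
def Returns (G : SimpleGraph V) (τ : V → Output Γ) : Prop :=
  ∀ x, ∃ r, A.output (A.stateAfter G r x) = some (τ x)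

/-- `𝒜(G) ∈ P(G)`: on input `G` all nodes halt, and their outputs are labels in `Γ` that form a
solution to the problem `P`. -/
def SolvesOn (P : GraphProblem Γ) (G : SimpleGraph V) : Prop :=
  ∃ σ ∈ P V G, A.Returns G fun x => Output.label (σ x)

/-- The algorithm solves `P` asymptotically almost surely on the random graph `G(n, 1/2)`. -/
def SolvesAAS (P : GraphProblem Γ) : Prop :=
  Tendsto
    (fun n : ℕ => SimpleGraph.binomialRandom (Fin n)
      (⟨1 / 2, by norm_num, by norm_num⟩ : unitInterval) {G | A.SolvesOn P G})
    atTop (𝓝 1)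

/-- The algorithm is sound for `P`: it solves `P` asymptotically almost surely, and on every input
on which it does not output a solution, all nodes output `failed`. -/
def IsSound (P : GraphProblem Γ) : Prop :=
  A.SolvesAAS P ∧
    ∀ (V : Type) [Finite V] (G : SimpleGraph V),
      ¬ A.SolvesOn P G → A.Returns G fun _ => Output.failed

/-- The algorithm is sound for `P` as an algorithm for connected networks: as `IsSound`, but nothing
is required of its behaviour on disconnected input graphs, apart from the (asymptotically
vanishing) part that they play in the first clause. -/
def IsSoundOnConnected (P : GraphProblem Γ) : Prop :=
  A.SolvesAAS P ∧
    ∀ (V : Type) [Finite V] (G : SimpleGraph V), G.Connected →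
      ¬ A.SolvesOn P G → A.Returns G fun _ => Output.failed

end MBAlgorithm

open Classical in
/-- `G` contains a Hamiltonian cycle. (Mathlib's `SimpleGraph.IsHamiltonian` also holds, by
convention, for the one-node graph, which contains no cycle.) -/
def HasHamiltonianCycle {V : Type} (G : SimpleGraph V) : Prop :=
  ∃ (a : V) (p : G.Walk a a), p.IsHamiltonianCycle

/-- The Hamiltonicity problem: at least one node outputs `yes` if and only if the input graph
contains a Hamiltonian cycle. -/
def hamiltonicity {Γ : Type u} (yes : Γ) : GraphProblem Γ :=
  fun _ _ G => {σ | (∃ x, σ x = yes) ↔ HasHamiltonianCycle G}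

/-! A node of a covering graph sends and receives exactly what the node below it does, so an
algorithm gives the cover the lifted output. It therefore suffices to find a Hamiltonian graph `G`
that the algorithm solves, with a connected cover that is not Hamiltonian: some node of `G` outputs
`yes`, hence so do its lifts, which is neither a solution nor `failed`.

The graph `G` comes from `G(n, 1/2)`: with probability at least 1/2, for suitable `n` and `m`, any
two nodes have `m` common neighbours and no `m` nodes are independent (`IsWellJoined`). A closure
argument makes such a graph Hamiltonian (`IsWellJoined.hasHamiltonianCycle`).

The cover has four sheets, joined only through three neighbours `a 1`, `a 2`, `a 3` of one node `u`.
For `i ≠ 0`, sheet `i` is attached to the rest by just two edges, one of them at `(u, 0)`. A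
Hamiltonian cycle must use both for each `i`, so it would have three edges at `(u, 0)`
(`IsTwist.not_hasHamiltonianCycle`). -/

/-- The edge probability `1 / 2`, as in the definition of `MBAlgorithm.SolvesAAS`. -/
noncomputable abbrev halfProb : unitInterval := ⟨1 / 2, by norm_num, by norm_num⟩

/-! ### Random graphs are well joined. -/

namespace SimpleGraph

section Random

open MeasureTheory ProbabilityTheory

variable {V : Type*}

lemma binomialRandom_edges_eq_le [Finite V] (F : Finset (Sym2 V)) (hF : ∀ e ∈ F, ¬ e.IsDiag)
    (g : Sym2 V → Prop) :
    binomialRandom V halfProb {G | ∀ e ∈ F, (e ∈ G.edgeSet ↔ g e)} ≤ 2⁻¹ ^ F.card := by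
  classical
  rw [binomialRandom_apply]
  refine (measure_mono (t := Set.pi (F : Set (Sym2 V)) fun e => {g e}) ?_).trans ?_
  · rintro _ ⟨G, hG, rfl⟩ e he
    exact propext (hG e he)
  · rw [Measure.infinitePi_pi _ fun i _ => MeasurableSet.of_discrete]
    refine Finset.prod_le_pow_card _ _ _ fun e he => ?_
    have h1 : (unitInterval.toNNReal halfProb : ENNReal) = 2⁻¹ := by
      rw [← ENNReal.coe_ofNat, ← ENNReal.coe_inv (by norm_num)]
      congr 1
      ext
      simp
    have h2 : (unitInterval.toNNReal (unitInterval.symm halfProb) : ENNReal) = 2⁻¹ := by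
      rw [← ENNReal.coe_ofNat, ← ENNReal.coe_inv (by norm_num)]
      congr 1
      ext
      simp
      norm_num
    have hd := hF e he
    by_cases hg : g e <;>
      simp [hg, hd, ENNReal.smul_def, h1, h2]

lemma binomialRandom_isIndepSet_le [Finite V] (T : Finset V) :
    binomialRandom V halfProb {G | G.IsIndepSet T} ≤ 2⁻¹ ^ T.card.choose 2 := by
  classical
  have key := binomialRandom_edges_eq_le (V := V) (T.sym2.filter fun e => ¬ e.IsDiag)
    (fun e he => (Finset.mem_filter.1 he).2) fun _ => False
  have hc : (T.sym2.filter fun e => ¬ e.IsDiag).card = T.card.choose 2 := by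
    have h1 := Sym2.card_image_offDiag T
    rw [← h1]
    congr 1
    ext e
    induction e with | h x y
    simp [Finset.mem_offDiag]
    grind
  rw [hc] at key
  refine (measure_mono ?_).trans key
  intro G hG e he
  induction e with | h x y
  simp only [Finset.mem_filter, Finset.mk_mem_sym2_iff, Sym2.mk_isDiag_iff] at he
  simpa using hG he.1.1 he.1.2 he.2

/-- For each `w ∈ T`, three of the four states of the pair `xw`, `yw` are allowed. This gives `3 ^
|T|` patterns on `2 |T|` distinct edges, each of probability at most `4⁻¹ ^ |T|`. -/
lemma binomialRandom_no_common_neighbor_le [Finite V] {x y : V} (hxy : x ≠ y) (T : Finset V)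
    (hx : x ∉ T) (hy : y ∉ T) :
    binomialRandom V halfProb {G | ∀ w ∈ T, ¬ (G.Adj x w ∧ G.Adj y w)} ≤ (3 / 4) ^ T.card := by
  classical
  let F : Finset (Sym2 V) := T.image (fun w => s(x, w)) ∪ T.image (fun w => s(y, w))
  have hFd : ∀ e ∈ F, ¬ e.IsDiag := by
    intro e he
    simp only [F, Finset.mem_union, Finset.mem_image] at he
    rcases he with ⟨w, hw, rfl⟩ | ⟨w, hw, rfl⟩ <;> simp <;> rintro rfl <;> contradiction
  have hFc : F.card = 2 * T.card := by
    rw [Finset.card_union_of_disjoint, Finset.card_image_of_injective, Finset.card_image_of_injective,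
      two_mul]
    · exact fun a b h => Sym2.congr_right.1 h
    · exact fun a b h => Sym2.congr_right.1 h
    · rw [Finset.disjoint_left]
      intro e h1 h2
      obtain ⟨w, hw, rfl⟩ := Finset.mem_image.1 h1
      obtain ⟨w', hw', h⟩ := Finset.mem_image.1 h2
      rw [Sym2.eq_iff] at h
      rcases h with ⟨h, -⟩ | ⟨h, -⟩
      · exact hxy h.symm
      · exact hy (h ▸ hw)
  -- The three patterns at `w`: only `xw` present, only `yw` present, or neither.
  let g : (T → Option Bool) → Sym2 V → Prop := fun f e =>
    ∃ w : T, (e = s(x, w.1) ∧ f w = some true) ∨ (e = s(y, w.1) ∧ f w = some false)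
  have hsub : {G : SimpleGraph V | ∀ w ∈ T, ¬ (G.Adj x w ∧ G.Adj y w)} ⊆
      ⋃ f : T → Option Bool, {G | ∀ e ∈ F, (e ∈ G.edgeSet ↔ g f e)} := by
    intro G hG
    refine Set.mem_iUnion.2 ⟨fun w => if G.Adj x w then some true else
      if G.Adj y w then some false else none, ?_⟩
    intro e he
    simp only [F, Finset.mem_union, Finset.mem_image] at he
    simp only [Set.mem_ofPred_eq] at hG
    rcases he with ⟨w, hw, rfl⟩ | ⟨w, hw, rfl⟩
    · constructor
      · intro h
        exact ⟨⟨w, hw⟩, Or.inl ⟨rfl, if_pos h⟩⟩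
      · rintro ⟨⟨w', hw'⟩, ⟨h, h'⟩ | ⟨h, h'⟩⟩
        · obtain rfl : w = w' := Sym2.congr_right.1 h
          by_contra hn
          rw [mem_edgeSet] at hn
          simp [hn] at h'
        · rw [Sym2.eq_iff] at h
          grind
    · constructor
      · intro h
        rw [mem_edgeSet] at h
        have := hG w hw
        exact ⟨⟨w, hw⟩, Or.inr ⟨rfl, by grind⟩⟩
      · rintro ⟨⟨w', hw'⟩, ⟨h, h'⟩ | ⟨h, h'⟩⟩
        · rw [Sym2.eq_iff] at h
          grind
        · obtain rfl : w = w' := Sym2.congr_right.1 h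
          rw [mem_edgeSet]
          grind
  calc _ ≤ _ := measure_mono hsub
    _ ≤ _ := measure_iUnion_fintype_le _ _
    _ ≤ ∑ f : T → Option Bool, (2⁻¹ : ENNReal) ^ (2 * T.card) :=
        Finset.sum_le_sum fun f _ => hFc ▸ binomialRandom_edges_eq_le F hFd (g f)
    _ = (3 / 4) ^ T.card := by
        simp only [Finset.sum_const, Finset.card_univ, Fintype.card_fun, Fintype.card_option,
          Fintype.card_bool, Fintype.card_coe, nsmul_eq_mul, pow_mul]
        push_cast
        rw [← mul_pow]
        congr 1
        rw [div_eq_mul_inv, ← ENNReal.inv_pow]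
        norm_num

/-- Any two distinct nodes have at least `m` common neighbours, and every set of `m` nodes spans
an edge. -/
structure IsWellJoined (G : SimpleGraph V) (m : ℕ) : Prop where
  exists_common : ∀ x y, x ≠ y → ∀ C : Finset V, C.card < m → ∃ w, w ∉ C ∧ G.Adj x w ∧ G.Adj y w
  not_isIndepSet : ∀ T : Finset V, T.card = m → ¬ G.IsIndepSet T

/-- A union bound over `m`-sets, and over pairs together with an `m`-set; the latter leaves at least
`n - (m + 2)` candidates for a common neighbour. -/
lemma binomialRandom_not_isWellJoined_le [Fintype V] {m : ℕ} (hm : m ≤ Fintype.card V) :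
    binomialRandom V halfProb {G | ¬ G.IsWellJoined m} ≤
      (Fintype.card V) ^ m * 2⁻¹ ^ m.choose 2 +
      (Fintype.card V) ^ (m + 2) * (3 / 4) ^ (Fintype.card V - (m + 2)) := by
  classical
  set n := Fintype.card V
  let P : Finset (Finset V) := Finset.univ.powersetCard m
  have hP : (P.card : ENNReal) ≤ n ^ m := by
    have : P.card ≤ n ^ m := by
      simpa [P] using Nat.choose_le_pow n m
    exact_mod_cast this
  have hsub : {G : SimpleGraph V | ¬ G.IsWellJoined m} ⊆
      (⋃ T ∈ P, {G | G.IsIndepSet T}) ∪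
      ⋃ q ∈ (Finset.univ : Finset (V × V)).filter (fun q => q.1 ≠ q.2) ×ˢ P,
        {G | ∀ w ∈ ((q.2 ∪ {q.1.1, q.1.2} : Finset V)ᶜ : Finset V),
          ¬ (G.Adj q.1.1 w ∧ G.Adj q.1.2 w)} := by
    intro G hG
    by_contra hcon
    simp only [Set.mem_union, Set.mem_iUnion, not_or, not_exists, P, Finset.mem_powersetCard,
      Finset.mem_product, Finset.mem_filter, Prod.forall] at hcon
    refine hG ⟨fun x y hxy C hC => ?_, fun T hT => hcon.1 T ⟨Finset.subset_univ _, hT⟩⟩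
    obtain ⟨D, hCD, hD⟩ := Finset.exists_superset_card_eq hC.le hm
    have := hcon.2 x y D ⟨⟨Finset.mem_univ _, hxy⟩, Finset.subset_univ _, hD⟩
    simp only [Set.mem_ofPred_eq, not_forall, not_not] at this
    obtain ⟨w, hw, h⟩ := this
    refine ⟨w, fun hwC => ?_, h⟩
    simp at hw
    exact hw.2.2 (hCD hwC)
  refine (measure_mono hsub).trans ((measure_union_le _ _).trans (add_le_add ?_ ?_))
  · refine (measure_biUnion_finset_le _ _).trans ?_
    refine (Finset.sum_le_card_nsmul _ _ (2⁻¹ ^ m.choose 2) fun T hT => ?_).trans ?_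
    · have := binomialRandom_isIndepSet_le T
      rwa [(Finset.mem_powersetCard.1 hT).2] at this
    · rw [nsmul_eq_mul]
      gcongr
  · refine (measure_biUnion_finset_le _ _).trans ?_
    refine (Finset.sum_le_card_nsmul _ _ ((3 / 4) ^ (n - (m + 2))) fun q hq => ?_).trans ?_
    · simp only [Finset.mem_product, Finset.mem_filter, P, Finset.mem_powersetCard] at hq
      refine (binomialRandom_no_common_neighbor_le hq.1.2 _ (by simp) (by simp)).trans ?_
      refine pow_le_pow_right_of_le_one' ?_ ?_
      · exact ENNReal.div_le_of_le_mul (by norm_num)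
      · rw [Finset.card_compl]
        have h1 := Finset.card_union_le q.2 {q.1.1, q.1.2}
        have h2 := Finset.card_le_two (a := q.1.1) (b := q.1.2)
        omega
    · rw [nsmul_eq_mul, Finset.card_product]
      have : (((Finset.univ : Finset (V × V)).filter (fun q => q.1 ≠ q.2)).card : ENNReal)
          ≤ n ^ 2 := by
        have : ((Finset.univ : Finset (V × V)).filter (fun q => q.1 ≠ q.2)).card ≤ n ^ 2 := by
          refine (Finset.card_filter_le _ _).trans ?_
          simp [n, sq]
        exact_mod_cast this
      rw [pow_add, Nat.cast_mul, mul_comm ((n : ENNReal) ^ m)]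
      gcongr

/-- With `n = 2 ^ j` and `m = 2 * j + 3`, this is `3 * (j * (m + 2) + 2) + (m + 2) ≤ n`: since `(3 /
4) ^ 3 ≤ 1 / 2`, it makes the common-neighbour term at most 1/4. -/
lemma exponent_bound {j : ℕ} (hj : 10 ≤ j) : 6 * j ^ 2 + 17 * j + 11 ≤ 2 ^ j := by
  induction j, hj using Nat.le_induction with
  | base => norm_num
  | succ j hj ih => rw [pow_succ 2]; nlinarith

lemma binomialRandom_not_isWellJoined_le_half {j : ℕ} (hj : 10 ≤ j) :
    binomialRandom (Fin (2 ^ j)) halfProb {G | ¬ G.IsWellJoined (2 * j + 3)} ≤ 1 / 2 := by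
  have hb := exponent_bound hj
  have h := binomialRandom_not_isWellJoined_le (V := Fin (2 ^ j)) (m := 2 * j + 3)
    (by rw [Fintype.card_fin]; nlinarith)
  rw [Fintype.card_fin] at h
  refine h.trans ?_
  have hinv : ∀ a b : ℕ, a + 2 ≤ b → (2 : ENNReal) ^ a * 2⁻¹ ^ b ≤ 1 / 4 := by
    intro a b hab
    obtain ⟨c, rfl⟩ := Nat.exists_eq_add_of_le hab
    have e : (2 : ENNReal) ^ a * 2⁻¹ ^ (a + 2 + c) = (2 * 2⁻¹) ^ a * (2⁻¹ ^ 2 * 2⁻¹ ^ c) := by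
      rw [mul_pow]; ring
    rw [e, ENNReal.mul_inv_cancel (by norm_num) (by norm_num), one_pow, one_mul]
    calc (2⁻¹ : ENNReal) ^ 2 * 2⁻¹ ^ c ≤ 2⁻¹ ^ 2 * 1 := by
          gcongr
          exact pow_le_one' (by simp) _
      _ = 1 / 4 := by rw [← ENNReal.inv_pow]; norm_num
  have h34 : (3 / 4 : ENNReal) ^ 3 ≤ 2⁻¹ := by
    rw [← ENNReal.toReal_le_toReal (by simp [ENNReal.div_eq_top]) (by simp)]
    simp
    norm_num
  have hle1 : (3 / 4 : ENNReal) ≤ 1 := ENNReal.div_le_of_le_mul (by norm_num)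
  have hfst : (((2 ^ j : ℕ) : ENNReal)) ^ (2 * j + 3) * 2⁻¹ ^ (2 * j + 3).choose 2 ≤ 1 / 4 := by
    push_cast
    rw [← pow_mul]
    apply hinv
    have : (2 * j + 3).choose 2 = (2 * j + 3) * (j + 1) := by
      rw [Nat.choose_two_right, show 2 * j + 3 - 1 = 2 * (j + 1) by omega,
        show (2 * j + 3) * (2 * (j + 1)) = 2 * ((2 * j + 3) * (j + 1)) by ring]
      simp
    rw [this]
    nlinarith
  have hsnd : (((2 ^ j : ℕ) : ENNReal)) ^ (2 * j + 3 + 2) *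
      (3 / 4) ^ (2 ^ j - (2 * j + 3 + 2)) ≤ 1 / 4 := by
    push_cast
    rw [← pow_mul]
    refine le_trans ?_ (hinv (j * (2 * j + 3 + 2)) (j * (2 * j + 3 + 2) + 2) le_rfl)
    refine mul_le_mul' le_rfl ?_
    calc (3 / 4 : ENNReal) ^ (2 ^ j - (2 * j + 3 + 2))
        ≤ (3 / 4) ^ (3 * (j * (2 * j + 3 + 2) + 2)) := by
          refine pow_le_pow_right_of_le_one' hle1 ?_
          apply Nat.le_sub_of_add_le
          nlinarith
      _ ≤ _ := by rw [pow_mul]; exact pow_le_pow_left' h34 _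
  calc _ ≤ (1 / 4 + 1 / 4 : ENNReal) := add_le_add hfst hsnd
    _ = 1 / 2 := by
      rw [← ENNReal.toReal_eq_toReal_iff' (by simp)
        (by simp), ENNReal.toReal_add (by simp) (by simp)]
      simp
      norm_num

end Random

end SimpleGraph

/-! ### Well-joined graphs are Hamiltonian. -/

namespace SimpleGraph

section Hamiltonian

variable {V : Type}

lemma Walk.IsCycle.mem_support_tail {G : SimpleGraph V} {a : V} {p : G.Walk a a} (hp : p.IsCycle)
    {x : V} (hx : x ∈ p.support) : x ∈ p.tail.support := by
  rw [Walk.support_tail_of_not_nil _ hp.not_nil]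
  rw [← Walk.cons_tail_support, List.mem_cons] at hx
  rcases hx with rfl | hx
  · exact Walk.end_mem_tail_support hp.not_nil
  · exact hx

lemma Walk.IsCycle.hasHamiltonianCycle {G : SimpleGraph V} {a : V} {p : G.Walk a a}
    (hp : p.IsCycle) (hmem : ∀ x, x ∈ p.support) : HasHamiltonianCycle G := by
  classical
  exact ⟨a, p, hp, hp.isPath_tail.isHamiltonian_of_mem fun x => hp.mem_support_tail (hmem x)⟩

lemma _root_.HasHamiltonianCycle.exists_spanning_cycle {G : SimpleGraph V}
    (h : HasHamiltonianCycle G) :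
    ∃ (a : V) (p : G.Walk a a), p.IsCycle ∧ ∀ x, x ∈ p.support := by
  classical
  obtain ⟨a, p, hp⟩ := h
  exact ⟨a, p, hp.isCycle, hp.mem_support⟩

lemma hasHamiltonianCycle_of_list {G : SimpleGraph V} {l : List V} (hnodup : l.Nodup)
    (hmem : ∀ x, x ∈ l) (hlen : 3 ≤ l.length) (hchain : l.IsChain G.Adj)
    (hclose : ∀ x ∈ l.getLast?, ∀ y ∈ l.head?, G.Adj x y) : HasHamiltonianCycle G := by
  classical
  have hne : l ≠ [] := by rintro rfl; simp at hlen
  have hadj : G.Adj (l.getLast hne) (l.head hne) :=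
    hclose _ (List.getLast_mem_getLast? hne) _ (List.head_mem_head? hne)
  let q := Walk.ofSupport l hne hchain
  have hq : q.support = l := Walk.support_ofSupport hne hchain
  have hpath : q.IsPath := Walk.IsPath.mk' (by rwa [hq])
  have hlen' : q.length = l.length - 1 := Walk.length_ofSupport hne hchain
  refine Walk.IsCycle.hasHamiltonianCycle (p := Walk.cons hadj q)
    ((Walk.cons_isCycle_iff _ _).2 ⟨hpath, fun h => ?_⟩) fun x => ?_
  · have hpen := hpath.eq_penultimate_of_mem_edges h
    nth_rw 1 [← q.getVert_zero] at hpen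
    have := hpath.getVert_injOn (by simp) (by simp) hpen
    omega
  · rw [Walk.support_cons, hq]
    exact List.mem_cons_of_mem _ (hmem x)

/-- The cycle must use the new edge; rotated to `x` and oriented so that its first step goes to `y`,
it leaves the path once that step is removed. -/
lemma exists_spanning_path_of_sup_edge {G : SimpleGraph V} {x y : V}
    (hG : ¬ HasHamiltonianCycle G) (h : HasHamiltonianCycle (G ⊔ edge x y)) :
    ∃ q : G.Walk y x, q.IsPath ∧ ∀ z, z ∈ q.support := by
  classical
  obtain ⟨a, p, hp, hspan⟩ := h.exists_spanning_cycle
  have hG' : ∀ e ∈ (G ⊔ edge x y).edgeSet, e ≠ s(x, y) → e ∈ G.edgeSet := by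
    intro e he hne
    rw [edgeSet_sup] at he
    exact he.resolve_right fun h => hne (edgeSet_edge_subset h)
  by_cases hmem : s(x, y) ∈ p.edges
  · have hx : x ∈ p.support := p.fst_mem_support_of_mem_edges hmem
    have hp' : (p.rotate x hx).IsCycle := hp.rotate hx
    obtain ⟨r, hr, hsnd, hverts⟩ := hp'.exists_isCycle_snd_verts_eq (w := y)
      (Walk.adj_toSubgraph_iff_mem_edges.2 ((p.rotate_edges x hx).mem_iff.2 hmem))
    have hrmem : ∀ z, z ∈ r.support := by
      intro z
      rw [← Walk.mem_verts_toSubgraph, hverts, Walk.mem_verts_toSubgraph, Walk.mem_support_rotate_iff]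
      exact hspan z
    rw [← hsnd]
    have hnot : s(x, r.snd) ∉ r.tail.edges := by
      have := hr
      rw [← r.cons_tail_eq hr.not_nil, Walk.cons_isCycle_iff] at this
      exact this.2
    have hsub : ∀ e ∈ r.tail.edges, e ∈ G.edgeSet := fun e he =>
      hG' e (r.tail.edges_subset_edgeSet he) fun h => hnot (by
        rwa [show s(x, r.snd) = e by rw [hsnd, h]])
    refine ⟨r.tail.transfer G hsub, hr.isPath_tail.transfer hsub, fun z => ?_⟩
    rw [Walk.support_transfer]
    exact hr.mem_support_tail (hrmem z)
  · have hsub : ∀ e ∈ p.edges, e ∈ G.edgeSet := fun e he =>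
      hG' e (p.edges_subset_edgeSet he) fun h => hmem (h ▸ he)
    refine (hG ((hp.transfer hsub).hasHamiltonianCycle fun z => ?_)).elim
    rw [Walk.support_transfer]
    exact hspan z

/-- Rerouting of a spanning path `A B C`: the cycle runs through `B`, then `A` backwards, then `C`.
-/
lemma hasHamiltonianCycle_of_append {G : SimpleGraph V} {A B C : List V}
    (hA : A ≠ []) (hB : B ≠ []) (hC : C ≠ [])
    (hnodup : (A ++ (B ++ C)).Nodup) (hmem : ∀ x, x ∈ A ++ (B ++ C))
    (hchain : (A ++ (B ++ C)).IsChain G.Adj)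
    (h1 : G.Adj (A.getLast hA) (B.getLast hB)) (h2 : G.Adj (A.head hA) (C.head hC))
    (h3 : G.Adj (C.getLast hC) (B.head hB)) : HasHamiltonianCycle G := by
  have hperm : (B ++ (A.reverse ++ C)).Perm (A ++ (B ++ C)) := by
    rw [← List.append_assoc, ← List.append_assoc]
    exact (List.perm_append_comm.trans ((List.reverse_perm A).append_right B)).append_right C
  refine hasHamiltonianCycle_of_list (l := B ++ (A.reverse ++ C)) (hperm.nodup_iff.2 hnodup)
    (fun x => hperm.mem_iff.2 (hmem x)) ?_ ?_ ?_
  · have := List.length_pos_of_ne_nil hA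
    have := List.length_pos_of_ne_nil hB
    have := List.length_pos_of_ne_nil hC
    simp
    omega
  · rw [List.isChain_append, List.isChain_append] at hchain
    obtain ⟨cA, ⟨cB, cC, -⟩, -⟩ := hchain
    rw [List.isChain_append, List.isChain_append]
    refine ⟨cB, ⟨?_, cC, ?_⟩, ?_⟩
    · rw [List.isChain_reverse]
      exact cA.imp fun _ _ h => h.symm
    · intro x hx y hy
      rw [List.getLast?_reverse, List.head?_eq_some_head hA] at hx
      rw [List.head?_eq_some_head hC] at hy
      cases hx; cases hy
      exact h2
    · intro x hx y hy
      rw [List.getLast?_eq_some_getLast hB] at hx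
      rw [List.head?_append, List.head?_reverse, List.getLast?_eq_some_getLast hA] at hy
      cases hx; cases hy
      exact h1.symm
  · intro x hx y hy
    rw [List.getLast?_append, List.getLast?_append, List.getLast?_eq_some_getLast hC] at hx
    rw [List.head?_append, List.head?_eq_some_head hB] at hy
    cases hx; cases hy
    exact h3

lemma IsWellJoined.mono {G H : SimpleGraph V} {m : ℕ} (hG : G.IsWellJoined m) (hGH : G ≤ H) :
    H.IsWellJoined m where
  exists_common x y hxy C hC := by
    obtain ⟨w, hw, h1, h2⟩ := hG.exists_common x y hxy C hC
    exact ⟨w, hw, hGH h1, hGH h2⟩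
  not_isIndepSet T hT h := hG.not_isIndepSet T hT fun x hx y hy hxy hadj => h hx hy hxy (hGH hadj)

lemma hasHamiltonianCycle_top [Fintype V] (h : 3 ≤ Fintype.card V) :
    HasHamiltonianCycle (⊤ : SimpleGraph V) := by
  have hn : (Finset.univ : Finset V).toList.Nodup := Finset.nodup_toList _
  have hl : 3 ≤ (Finset.univ : Finset V).toList.length := by simpa using h
  refine hasHamiltonianCycle_of_list hn (by simp) hl ?_ ?_
  · exact List.Pairwise.isChain (hn.imp fun h => h)
  · intro x hx y hy
    rw [top_adj]
    generalize (Finset.univ : Finset V).toList = l at *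
    match l with
    | a :: b :: c :: t =>
      simp only [List.head?_cons, Option.mem_def, Option.some.injEq] at hy
      subst hy
      rintro rfl
      rw [List.getLast?_cons_cons] at hx
      have := List.mem_of_getLast? hx
      exact (List.nodup_cons.1 hn).1 this

/-- Induction from the complete graph downwards: adding a missing edge `xy` keeps the graph well
joined, so a non-Hamiltonian `G` has a spanning path from `y` to `x`. Among the predecessors on it
of the common neighbours of `x` and `y`, two are adjacent, which allows a rerouting. -/
theorem IsWellJoined.hasHamiltonianCycle [Fintype V] {m : ℕ} (hV : 3 ≤ Fintype.card V)
    (G : SimpleGraph V) (hG : G.IsWellJoined m) : HasHamiltonianCycle G := by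
  classical
  induction G using WellFoundedGT.induction with | ind G ih
  by_contra hham
  by_cases htop : G = ⊤
  · exact hham (htop ▸ hasHamiltonianCycle_top hV)
  obtain ⟨x, y, hxy, hadj⟩ : ∃ x y, x ≠ y ∧ ¬ G.Adj x y := by
    by_contra! hcon
    exact htop (by ext x y; exact ⟨fun h => h.ne, hcon x y⟩)
  obtain ⟨q, hq, hmem⟩ := exists_spanning_path_of_sup_edge hham
    (ih _ (lt_sup_edge _ _ _ hxy hadj) (hG.mono le_sup_left))
  let N : Finset V := Finset.univ.filter fun w => G.Adj x w ∧ G.Adj y w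
  have hN : m ≤ N.card := by
    by_contra! hlt
    obtain ⟨w, hw, h⟩ := hG.exists_common x y hxy N hlt
    exact hw (Finset.mem_filter.2 ⟨Finset.mem_univ _, h⟩)
  let I : Finset ℕ := (Finset.range q.length).filter fun i => q.getVert (i + 1) ∈ N
  -- Every common neighbour has a predecessor, because the path starts at `y`, which is not its own
  -- neighbour.
  have hNI : N ⊆ I.image fun i => q.getVert (i + 1) := by
    intro w hw
    obtain ⟨k, rfl, hk⟩ := Walk.mem_support_iff_exists_getVert.1 (hmem w)
    cases k with
    | zero => simp [N] at hw
    | succ k => exact Finset.mem_image.2 ⟨k, Finset.mem_filter.2 ⟨Finset.mem_range.2 hk, hw⟩, rfl⟩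
  have hinj : Set.InjOn q.getVert (I : Set ℕ) := fun i hi j hj hij =>
    hq.getVert_injOn (by simp [I] at hi ⊢; omega) (by simp [I] at hj ⊢; omega) hij
  have hcard : m ≤ (I.image q.getVert).card := by
    rw [Finset.card_image_of_injOn hinj]
    exact hN.trans ((Finset.card_le_card hNI).trans Finset.card_image_le)
  obtain ⟨T, hTI, hT⟩ := Finset.exists_subset_card_eq hcard
  obtain ⟨i, hi, j, hj, hij, hadj⟩ : ∃ i ∈ I, ∃ j ∈ I, i < j ∧
      G.Adj (q.getVert i) (q.getVert j) := by
    by_contra! hcon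
    refine hG.not_isIndepSet T hT fun a ha b hb hab hadj => ?_
    obtain ⟨i, hi, rfl⟩ := Finset.mem_image.1 (hTI ha)
    obtain ⟨j, hj, rfl⟩ := Finset.mem_image.1 (hTI hb)
    rcases lt_trichotomy i j with h | rfl | h
    · exact hcon i hi j hj h hadj
    · exact hab rfl
    · exact hcon j hj i hi h hadj.symm
  simp only [I, N, Finset.mem_filter, Finset.mem_range, Finset.mem_univ, true_and] at hi hj
  have hlen : q.support.length = q.length + 1 := q.length_support
  have hget : ∀ k (hk : k < q.support.length), q.support[k] = q.getVert k := fun k hk =>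
    (q.getVert_eq_support_getElem (by omega)).symm
  have hsplit : q.support.take (i + 1) ++ (((q.support.drop (i + 1)).take (j - i)) ++
      q.support.drop (j + 1)) = q.support := by
    have : q.support.drop (j + 1) = (q.support.drop (i + 1)).drop (j - i) := by
      rw [List.drop_drop]; congr 1; omega
    rw [this, List.take_append_drop, List.take_append_drop]
  -- The path is cut after positions `i` and `j`. The new edges join positions `i` and `j`, `y` and
  -- position `j + 1`, `x` and position `i + 1`.
  refine hham (hasHamiltonianCycle_of_append (A := q.support.take (i + 1))
    (B := (q.support.drop (i + 1)).take (j - i)) (C := q.support.drop (j + 1)) ?_ ?_ ?_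
    (hsplit.symm ▸ hq.support_nodup) (hsplit.symm ▸ hmem)
    (hsplit.symm ▸ q.isChain_adj_support) ?_ ?_ ?_)
  · exact List.ne_nil_of_length_pos (by simp)
  · exact List.ne_nil_of_length_pos (by simp; omega)
  · exact List.ne_nil_of_length_pos (by simp; omega)
  · convert hadj using 1
    · rw [List.getLast_eq_getElem, List.getElem_take, hget]
      congr 1; simp; omega
    · rw [List.getLast_eq_getElem, List.getElem_take, List.getElem_drop, hget]
      congr 1; simp; omega
  · convert hj.2.2 using 1
    · rw [List.head_eq_getElem, List.getElem_take, hget, Walk.getVert_zero]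
    · rw [List.head_eq_getElem, List.getElem_drop, hget]
  · convert hi.2.1 using 1
    · rw [List.getLast_eq_getElem, List.getElem_drop, hget]
      exact q.getVert_of_length_le (by simp; omega)
    · rw [List.head_eq_getElem, List.getElem_take, List.getElem_drop, hget]

end Hamiltonian

end SimpleGraph

/-! ### The twisted four-fold cover. -/

namespace SimpleGraph

section TwistedCover

variable {V : Type} {G : SimpleGraph V} {u : V} {c : V → Fin 4} {a : Fin 4 → V}

theorem IsWellJoined.connected [Nonempty V] {m : ℕ} (hG : G.IsWellJoined m) (hm : 1 ≤ m) :
    G.Connected where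
  preconnected x y := by
    by_cases hxy : x = y
    · rw [hxy]
    · obtain ⟨w, -, h1, h2⟩ := hG.exists_common x y hxy ∅ (by simpa)
      exact h1.reachable.trans h2.symm.reachable

/-- The sheet labels `c` single out three neighbours `a 1`, `a 2`, `a 3` of `u`. -/
structure IsTwist (G : SimpleGraph V) (u : V) (c : V → Fin 4) (a : Fin 4 → V) : Prop where
  adj : ∀ i, i ≠ 0 → G.Adj u (a i)
  eq_iff : ∀ i, i ≠ 0 → ∀ y, c y = i ↔ y = a i

lemma IsTwist.apply (h : G.IsTwist u c a) {i : Fin 4} (hi : i ≠ 0) : c (a i) = i :=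
  (h.eq_iff i hi _).2 rfl

lemma IsWellJoined.exists_isTwist [Nontrivial V] {m : ℕ} (hG : G.IsWellJoined m) (hm : 3 ≤ m) :
    ∃ (u : V) (c : V → Fin 4) (a : Fin 4 → V), G.IsTwist u c a := by
  classical
  obtain ⟨u, x, hux⟩ := exists_pair_ne V
  obtain ⟨w₁, -, h1, -⟩ := hG.exists_common u x hux ∅ (by simp; omega)
  obtain ⟨w₂, n2, h2, -⟩ := hG.exists_common u x hux {w₁} (by simp; omega)
  obtain ⟨w₃, n3, h3, -⟩ := hG.exists_common u x hux {w₁, w₂}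
    (lt_of_le_of_lt Finset.card_le_two (by omega))
  simp only [Finset.mem_singleton, Finset.mem_insert, not_or] at n2 n3
  refine ⟨u, fun y => if y = w₁ then 1 else if y = w₂ then 2 else if y = w₃ then 3 else 0,
    -- The entry at `0` is a dummy.
    ![u, w₁, w₂, w₃], ?_, ?_⟩
  · intro i hi
    fin_cases i
    · exact (hi rfl).elim
    · exact h1
    · exact h2
    · exact h3
  · intro i hi y
    fin_cases i
    · exact (hi rfl).elim
    all_goals
      simp
      grind

variable [DecidableEq V]

/-- The permutation of the four sheets along the edge `xy`: an edge at `u` whose other end is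
`y` swaps the sheets `0` and `c y`, and all other edges preserve the sheets. -/
def sheetPerm (u : V) (c : V → Fin 4) (x y : V) : Equiv.Perm (Fin 4) :=
  if x = u then Equiv.swap 0 (c y) else if y = u then Equiv.swap 0 (c x) else 1

/-- The four-fold cover of `G` that is twisted only at the node `u`. -/
def twistedCover (G : SimpleGraph V) (u : V) (c : V → Fin 4) : SimpleGraph (V × Fin 4) where
  Adj p q := G.Adj p.1 q.1 ∧ q.2 = sheetPerm u c p.1 q.1 p.2
  symm := ⟨by
    rintro ⟨x, i⟩ ⟨y, j⟩ ⟨hadj, h⟩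
    refine ⟨hadj.symm, ?_⟩
    have hne : x ≠ y := hadj.ne
    simp only [sheetPerm] at h ⊢
    subst h
    split_ifs <;> simp_all⟩
  loopless := ⟨fun p h => G.loopless.irrefl _ h.1⟩

lemma twistedCover_adj {p q : V × Fin 4} :
    (G.twistedCover u c).Adj p q ↔ G.Adj p.1 q.1 ∧ q.2 = sheetPerm u c p.1 q.1 p.2 := Iff.rfl

lemma map_fst_neighbours_twistedCover [Finite V] (p : V × Fin 4) :
    (neighbours (G.twistedCover u c) p).val.map Prod.fst = (neighbours G p.1).val := by
  let f : V ↪ V × Fin 4 := ⟨fun y => (y, sheetPerm u c p.1 y p.2), fun a b h => congrArg Prod.fst h⟩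
  have : neighbours (G.twistedCover u c) p = (neighbours G p.1).map f := by
    ext ⟨y, j⟩
    simp only [neighbours, Set.Finite.mem_toFinset, mem_neighborSet, Finset.mem_map,
      twistedCover_adj]
    constructor
    · rintro ⟨h1, h2⟩
      exact ⟨y, h1, Prod.ext rfl h2.symm⟩
    · rintro ⟨_, h1, h2⟩
      cases h2
      exact ⟨h1, rfl⟩
  rw [this, Finset.map_val, Multiset.map_map]
  exact Multiset.map_id _

/-- Only the edge between `u` and `a i` has a permutation that moves sheet `i`, and its lifts
meeting that sheet are these two. -/
lemma IsTwist.edge_eq_of_enters (h : G.IsTwist u c a) {i : Fin 4} (hi : i ≠ 0) {p q : V × Fin 4}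
    (hpq : (G.twistedCover u c).Adj p q) (hp : p.2 ≠ i) (hq : q.2 = i) :
    s(p, q) = s((u, 0), (a i, i)) ∨ s(p, q) = s((a i, 0), (u, i)) := by
  obtain ⟨x, k⟩ := p
  obtain ⟨y, l⟩ := q
  obtain ⟨-, h2⟩ := hpq
  simp only at hp hq h2
  subst hq
  simp only [sheetPerm] at h2
  split_ifs at h2 with h3 h4
  · rw [Equiv.swap_apply_def] at h2
    left
    split_ifs at h2 with h5 h6
    · rw [(h.eq_iff l hi y).1 h2.symm, h3, h5]
    · exact (hi h2).elim
    · exact (hp h2.symm).elim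
  · rw [Equiv.swap_apply_def] at h2
    right
    split_ifs at h2 with h5 h6
    · rw [(h.eq_iff l hi x).1 h2.symm, h4, h5]
    · exact (hi h2).elim
    · exact (hp h2.symm).elim
  · exact (hp h2.symm).elim

/-- The cycle enters sheet `i` before `(a i, i)` and leaves it afterwards, by different edges; as
only two edges cross, both are used. -/
lemma IsTwist.mem_edges_of_isCycle (h : G.IsTwist u c a) {i : Fin 4} (hi : i ≠ 0)
    {p : (G.twistedCover u c).Walk (u, 0) (u, 0)} (hp : p.IsCycle) (hmem : (a i, i) ∈ p.support) :
    s((u, 0), (a i, i)) ∈ p.edges := by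
  let S : Set (V × Fin 4) := {q | q.2 = i}
  have hz : (a i, i) ∈ S := rfl
  have hu : ((u, 0) : V × Fin 4) ∉ S := fun h => hi h.symm
  obtain ⟨d, hd, hd1, hd2⟩ := (p.takeUntil _ hmem).exists_boundary_dart Sᶜ hu (fun h => h hz)
  obtain ⟨d', hd', hd1', hd2'⟩ := (p.dropUntil _ hmem).exists_boundary_dart S hz hu
  have hnd : ((p.takeUntil _ hmem).edges ++ (p.dropUntil _ hmem).edges).Nodup := by
    rw [← Walk.edges_append, Walk.take_spec]
    exact hp.isTrail.edges_nodup
  have hed : d.edge ∈ (p.takeUntil _ hmem).edges := List.mem_map_of_mem hd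
  have hed' : d'.edge ∈ (p.dropUntil _ hmem).edges := List.mem_map_of_mem hd'
  have hne : d.edge ≠ d'.edge := (List.nodup_append.1 hnd).2.2 _ hed _ hed'
  have e1 := h.edge_eq_of_enters hi d.adj hd1 (not_not.1 hd2)
  have e2 := h.edge_eq_of_enters hi d'.adj.symm hd2' hd1'
  rw [Sym2.eq_swap (a := d'.snd)] at e2
  change d.edge = _ ∨ d.edge = _ at e1
  change d'.edge = _ ∨ d'.edge = _ at e2
  rcases e1 with e1 | e1
  · exact p.edges_takeUntil_subset_edges hmem (e1 ▸ hed)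
  · rcases e2 with e2 | e2
    · exact p.edges_dropUntil_subset_edges hmem (e2 ▸ hed')
    · exact (hne (e1.trans e2.symm)).elim

theorem IsTwist.not_hasHamiltonianCycle (h : G.IsTwist u c a) :
    ¬ HasHamiltonianCycle (G.twistedCover u c) := by
  intro hham
  obtain ⟨b, p, hp, hmem⟩ := hham.exists_spanning_cycle
  have hu := hmem (u, 0)
  have hcyc : (p.rotate _ hu).IsCycle := hp.rotate hu
  have key : ∀ i : Fin 4, i ≠ 0 →
      ((a i, i) : V × Fin 4) ∈ ({(p.rotate _ hu).snd, (p.rotate _ hu).penultimate} : Set _) := by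
    intro i hi
    rw [← hcyc.neighborSet_toSubgraph_endpoint, Subgraph.mem_neighborSet,
      Walk.adj_toSubgraph_iff_mem_edges]
    refine h.mem_edges_of_isCycle hi hcyc ?_
    rw [Walk.mem_support_rotate_iff]
    exact hmem _
  have k1 := key 1 (by decide)
  have k2 := key 2 (by decide)
  have k3 := key 3 (by decide)
  generalize (p.rotate _ hu).snd = s, (p.rotate _ hu).penultimate = t at k1 k2 k3
  simp only [Set.mem_insert_iff, Set.mem_singleton_iff] at k1 k2 k3
  have n12 : ((a 1, 1) : V × Fin 4) ≠ (a 2, 2) := by simp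
  have n13 : ((a 1, 1) : V × Fin 4) ≠ (a 3, 3) := by simp
  have n23 : ((a 2, 2) : V × Fin 4) ≠ (a 3, 3) := by simp
  grind

/-- Common neighbours other than `u` connect each sheet without its copy of `u`. Sheets `i ≠ 0`
reach `(u, 0)` through `(a i, i)`, each `(u, i)` with `i ≠ 0` joins its own sheet through some `a
j`, `j ≠ i`, and sheet `0` is reached from `(u, 1)` through `(a 1, 0)`. -/
theorem IsTwist.connected (h : G.IsTwist u c a) {m : ℕ} (hG : G.IsWellJoined m) (hm : 2 ≤ m) :
    (G.twistedCover u c).Connected := by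
  have same : ∀ x y i, x ≠ u → y ≠ u → (G.twistedCover u c).Reachable (x, i) (y, i) := by
    intro x y i hx hy
    by_cases hxy : x = y
    · rw [hxy]
    · obtain ⟨w, hw, h1, h2⟩ := hG.exists_common x y hxy {u} (by simpa)
      have hwu : w ≠ u := by simpa using hw
      have e1 : (G.twistedCover u c).Adj (x, i) (w, i) := ⟨h1, by simp [sheetPerm, hx, hwu]⟩
      have e2 : (G.twistedCover u c).Adj (y, i) (w, i) := ⟨h2, by simp [sheetPerm, hy, hwu]⟩
      exact e1.reachable.trans e2.symm.reachable
  have hne : ∀ i, i ≠ 0 → a i ≠ u := fun i hi => (h.adj i hi).ne'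
  have up : ∀ i x, i ≠ 0 → x ≠ u → (G.twistedCover u c).Reachable (x, i) (u, 0) := by
    intro i x hi hx
    have e : (G.twistedCover u c).Adj (u, 0) (a i, i) :=
      ⟨h.adj i hi, by simp [sheetPerm, h.apply hi]⟩
    exact (same x (a i) i hx (hne i hi)).trans e.symm.reachable
  have centre : ∀ i, (G.twistedCover u c).Reachable (u, i) (u, 0) := by
    intro i
    by_cases hi : i = 0
    · rw [hi]
    obtain ⟨j, hj, hji⟩ : ∃ j : Fin 4, j ≠ 0 ∧ j ≠ i := by revert i; decide
    have e : (G.twistedCover u c).Adj (u, i) (a j, i) :=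
      ⟨h.adj j hj, by simp [sheetPerm, h.apply hj, Equiv.swap_apply_of_ne_of_ne hi hji.symm]⟩
    exact e.reachable.trans (up i _ hi (hne j hj))
  have all : ∀ p, (G.twistedCover u c).Reachable p (u, 0) := by
    rintro ⟨x, i⟩
    by_cases hx : x = u
    · rw [hx]; exact centre i
    by_cases hi : i = 0
    · subst hi
      have e : (G.twistedCover u c).Adj (u, 1) (a 1, 0) :=
        ⟨h.adj 1 (by decide), by simp [sheetPerm, h.apply (i := 1) (by decide)]⟩
      exact (same x (a 1) 0 hx (hne 1 (by decide))).trans (e.symm.reachable.trans (centre 1))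
    · exact up i x hi hx
  exact { preconnected := fun p q => (all p).trans (all q).symm, nonempty := ⟨(u, 0)⟩ }

end TwistedCover

end SimpleGraph

/-! ### Algorithms on covering graphs, and the conclusion. -/

namespace MBAlgorithm

variable {Γ : Type u} (A : MBAlgorithm.{u, v, w} Γ) {V W : Type} [Finite V] [Finite W]
  {G : SimpleGraph V} {H : SimpleGraph W}

/-- Nodes of a covering graph behave as the nodes that they cover. -/
lemma stateAfter_of_covering {φ : W → V}
    (hφ : ∀ p, (neighbours H p).val.map φ = (neighbours G (φ p)).val) (r : ℕ) (p : W) :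
    A.stateAfter H r p = A.stateAfter G r (φ p) := by
  induction r generalizing p with
  | zero =>
    have := congrArg Multiset.card (hφ p)
    rw [Multiset.card_map] at this
    simp only [stateAfter, Finset.card, this]
  | succ r ih =>
    simp only [stateAfter, ih, ← hφ p, Multiset.map_map, Function.comp_def]

lemma Returns.of_covering {A : MBAlgorithm.{u, v, w} Γ} {φ : W → V}
    (hφ : ∀ p, (neighbours H p).val.map φ = (neighbours G (φ p)).val) {τ : V → Output Γ}
    (h : A.Returns G τ) : A.Returns H (τ ∘ φ) := by
  intro p
  obtain ⟨r, hr⟩ := h (φ p)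
  exact ⟨r, by rw [A.stateAfter_of_covering hφ, hr, Function.comp]⟩

lemma stateAfter_eq_of_halted {r s : ℕ} (hrs : r ≤ s) {x : V}
    (h : (A.output (A.stateAfter G r x)).isSome) : A.stateAfter G s x = A.stateAfter G r x := by
  induction s, hrs using Nat.le_induction with
  | base => rfl
  | succ s hs ih => rw [stateAfter, ih, if_pos h]

lemma Returns.unique {A : MBAlgorithm.{u, v, w} Γ} {τ τ' : V → Output Γ} (h : A.Returns G τ)
    (h' : A.Returns G τ') : τ = τ' := by
  funext x
  obtain ⟨r, hr⟩ := h x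
  obtain ⟨s, hs⟩ := h' x
  have e1 := A.stateAfter_eq_of_halted (le_max_left r s) (by rw [hr]; rfl)
  have e2 := A.stateAfter_eq_of_halted (le_max_right r s) (by rw [hs]; rfl)
  rw [← e1] at hr
  rw [← e2, hr] at hs
  exact Option.some.inj hs

/-- For large `j` the algorithm succeeds with probability above 1/2, so success cannot lie inside
the event, of probability at most 1/2, that the graph is not well joined. -/
lemma SolvesAAS.exists_isWellJoined {A : MBAlgorithm.{u, v, w} Γ} {P : GraphProblem Γ}
    (h : A.SolvesAAS P) : ∃ (j : ℕ) (G : SimpleGraph (Fin (2 ^ j))),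
      10 ≤ j ∧ G.IsWellJoined (2 * j + 3) ∧ A.SolvesOn P G := by
  have h1 := h.comp (tendsto_pow_atTop_atTop_of_one_lt (r := 2) (by norm_num))
  have h2 := h1.eventually (lt_mem_nhds (show (1 / 2 : ENNReal) < 1 by simp))
  obtain ⟨j, hj, hj10⟩ := (h2.and (eventually_ge_atTop 10)).exists
  by_contra! hcon
  refine (hj.trans_le ?_).not_ge (SimpleGraph.binomialRandom_not_isWellJoined_le_half hj10)
  exact MeasureTheory.measure_mono fun G hG hw => hcon j G hj10 hw hG

end MBAlgorithm

lemma not_isSoundOnConnected_of_eq_hamiltonicity {Γ : Type u} (yes : Γ) (P : GraphProblem Γ)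
    (hP : ∀ (V : Type) [Finite V] (G : SimpleGraph V), G.Connected →
      P V G = hamiltonicity yes V G) (A : MBAlgorithm.{u, v, w} Γ) : ¬ A.IsSoundOnConnected P := by
  rintro ⟨haas, hfail⟩
  obtain ⟨j, G, hj, hG, σ, hσ, hret⟩ := haas.exists_isWellJoined
  have hcard : 3 ≤ Fintype.card (Fin (2 ^ j)) := by
    rw [Fintype.card_fin]
    exact le_trans (by norm_num) (Nat.pow_le_pow_right two_pos hj)
  have : Nontrivial (Fin (2 ^ j)) := Fintype.one_lt_card_iff_nontrivial.1 (by omega)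
  obtain ⟨u, c, a, htw⟩ := hG.exists_isTwist (by omega)
  rw [hP _ G (hG.connected (by omega))] at hσ
  obtain ⟨x, hx⟩ := hσ.2 (hG.hasHamiltonianCycle hcard)
  have hconn := htw.connected hG (by omega)
  have hret' := hret.of_covering (SimpleGraph.map_fst_neighbours_twistedCover (u := u) (c := c))
  -- Outputs are unique, so the lifted labeling, which contains `yes`, would have to be a solution
  -- on a non-Hamiltonian graph, or else equal `failed` everywhere.
  by_cases hsol : A.SolvesOn P (G.twistedCover u c)
  · obtain ⟨σ', hσ', hret''⟩ := hsol
    rw [hP _ _ hconn] at hσ'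
    refine htw.not_hasHamiltonianCycle (hσ'.1 ⟨(x, 0), ?_⟩)
    have := congrFun (hret''.unique hret') (x, 0)
    rw [← hx]
    exact Output.label.inj this
  · have := congrFun ((hfail _ _ hconn hsol).unique hret') (x, 0)
    cases this

theorem mainTheorem7 {Γ : Type u} (yes : Γ) :
    (¬ ∃ A : MBAlgorithm.{u, v, w} Γ, A.IsSound (hamiltonicity yes)) ∧
    ∀ P : GraphProblem Γ,
      (∀ (V : Type) [Finite V] (G : SimpleGraph V), G.Connected → P V G = hamiltonicity yes V G) →
      ¬ ∃ A : MBAlgorithm.{u, v, w} Γ, A.IsSoundOnConnected P := by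
  refine ⟨?_, fun P hP => ?_⟩
  · rintro ⟨A, hA⟩
    exact not_isSoundOnConnected_of_eq_hamiltonicity yes (hamiltonicity yes) (fun _ _ _ _ => rfl) A
      ⟨hA.1, fun V _ G _ => hA.2 V G⟩
  · rintro ⟨A, hA⟩
    exact not_isSoundOnConnected_of_eq_hamiltonicity yes P hP A hA
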